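/- Let $X$ be a connected compact Riemann surface (equivalently, a compact one-dimensional irreducible normal complex space) and let $\Delta=\sum_i\left(1-\frac1{m_i}\right)[p_i]$ be an orbifold divisor on $X$ with distinct points $p_i\in X$ and finite integer multiplicities $m_i\ge 2$, so that $(X/\Delta)$ is a one-dimensional compact orbifold; write $|\Delta|=\{p_i\}$. An orbifold morphism from the unit disc $D$ to $(X/\Delta)$ is a holomorphic map $h:D\to X$ with $h(D)\not\subset|\Delta|$ such that, for every $i$ and every $z\in D$ with $h(z)=p_i$, the multiplicity of $h^*[p_i]$ at $z$ is at least $m_i$. An orbifold morphism $\mathbb C\to(X/\Delta)$ is a holomorphic map $f:\mathbb C\to X$ with $f(\mathbb C)\not\subset|\Delta|$ such that $f\circ g$ is an orbifold morphism from $D$ to $(X/\Delta)$ for every holomorphic map $g:D\to\mathbb C$ with $f(g(D))\not\subset|\Delta|$. The orbifold Kobayashi pseudodistance of $(X/\Delta)$ is the largest pseudodistance on $X$ for which all orbifold morphisms from $D$ to $(X/\Delta)$ are distance-decreasing with respect to the Poincaré distance on $D$, and $(X/\Delta)$ is called orbifold hyperbolic if this pseudodistance is a distance. Then $(X/\Delta)$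 is orbifold hyperbolic, or there exists a non-constant orbifold morphism $f:\mathbb C\to(X/\Delta)$ whose derivative is bounded with respect to the Euclidean metric on $\mathbb C$ and any hermitian metric on $X$. -/

import Mathlib

open scoped Manifold ContDiff Topology ComplexConjugate ENNReal

noncomputable section

namespace Orbicurve

/-- The open unit disc `D` in `ℂ`. -/
abbrev disc : Set ℂ := Metric.ball (0 : ℂ) 1

/-- The Poincaré distance on the unit disc, induced by the metric `4 |dz|² / (1 - |z|²)²`. -/
def poincareDist (z w : ℂ) : ℝ :=
  2 * Real.artanh (‖z - w‖ / ‖1 - conj w * z‖)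

/-- An orbifold divisor `Δ = ∑ (1 - 1 / mᵢ) [Zᵢ]` on a complex curve `X`. The irreducible
hypersurfaces `Zᵢ` are points; `mult p` is the multiplicity of the point `p`, with `mult p = 1`
if `p` is not in the support of `Δ`, and `mult p = ∞` if `p` has weight `1`. -/
structure OrbifoldDivisor (X : Type*) [TopologicalSpace X] where
  mult : X → ℕ∞
  one_le_mult : ∀ p, 1 ≤ mult p
  locallyFinite : ∀ x, ∃ U ∈ 𝓝 x, (U ∩ {p | mult p ≠ 1}).Finite

namespace OrbifoldDivisor

/-- The empty divisor. -/
def empty (X : Type*) [TopologicalSpace X] : OrbifoldDivisor X where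
  mult := fun _ => 1
  one_le_mult := fun _ => le_rfl
  locallyFinite := fun _ => ⟨Set.univ, Filter.univ_mem, by simp⟩

variable {X : Type*} [TopologicalSpace X] (Δ : OrbifoldDivisor X)

/-- The support `|Δ|`. -/
def support : Set X := {p | Δ.mult p ≠ 1}

/-- The union `Δ₁` of the components of infinite multiplicity (that is, of weight `1`). -/
def infPart : Set X := {p | Δ.mult p = ⊤}

/-- The orbifold `(X/Δ)` is compact: `X` is compact and `Δ` has no component of weight `1`. -/
def IsCompactOrbifold : Prop := CompactSpace X ∧ Δ.infPart = ∅

end OrbifoldDivisor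

section Morphisms

variable {X : Type*} [TopologicalSpace X] [ChartedSpace ℂ X]

/-- The multiplicity at `z` of the pulled back divisor `h^*[p]`, where `h z = p`: the vanishing
order at `z` of `φ ∘ h - φ p`, where `φ` is a holomorphic coordinate of `X` around `p`. -/
def pullbackMult (h : ℂ → X) (p : X) (z : ℂ) : ℕ∞ :=
  analyticOrderAt (fun w => chartAt ℂ p (h w) - chartAt ℂ p p) z

/-- `h` restricts to a (non-classical) orbifold morphism from the unit disc to `(X/Δ)`. Only the
values of `h` on the disc matter. -/
structure IsDiscMorphism (Δ : OrbifoldDivisor X) (h : ℂ → X) : Prop where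
  holo : MDifferentiableOn 𝓘(ℂ) 𝓘(ℂ) h disc
  not_subset : ¬ (h '' disc ⊆ Δ.support)
  mult_le : ∀ z ∈ disc, h z ∈ Δ.support → Δ.mult (h z) ≤ pullbackMult h (h z) z
  avoid : ∀ z ∈ disc, h z ∉ Δ.infPart

/-- `f` is a (non-classical) orbifold morphism from `(Y/Δ)` to `(X/Δ')`. Only the values of `f`
outside the components of infinite multiplicity of `Δ` matter. -/
structure IsOrbifoldMorphism {Y : Type*} [TopologicalSpace Y] [ChartedSpace ℂ Y]
    (Δ : OrbifoldDivisor Y) (Δ' : OrbifoldDivisor X) (f : Y → X) : Prop where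
  holo : MDifferentiableOn 𝓘(ℂ) 𝓘(ℂ) f Δ.infPartᶜ
  not_subset : ¬ (f '' Δ.infPartᶜ ⊆ Δ'.support)
  comp_disc : ∀ g : ℂ → Y, IsDiscMorphism Δ g → ¬ (g '' disc ⊆ f ⁻¹' Δ'.support) →
    IsDiscMorphism Δ' (f ∘ g)

end Morphisms

/-- `δ` is a pseudodistance on the set `S`. -/
structure IsPseudodistOn {X : Type*} (S : Set X) (δ : X → X → ℝ) : Prop where
  nonneg : ∀ x ∈ S, ∀ y ∈ S, 0 ≤ δ x y
  self : ∀ x ∈ S, δ x x = 0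
  symm : ∀ x ∈ S, ∀ y ∈ S, δ x y = δ y x
  triangle : ∀ x ∈ S, ∀ y ∈ S, ∀ z ∈ S, δ x z ≤ δ x y + δ y z

section Kobayashi

variable {X : Type*} [TopologicalSpace X] [ChartedSpace ℂ X]

/-- `δ` is a pseudodistance on `X \ Δ₁` for which all orbifold morphisms from the unit disc to
`(X/Δ)` are distance decreasing with respect to the Poincaré distance. -/
structure IsDiscDecreasing (Δ : OrbifoldDivisor X) (δ : X → X → ℝ) : Prop where
  pseudodist : IsPseudodistOn Δ.infPartᶜ δ
  decreasing : ∀ h : ℂ → X, IsDiscMorphism Δ h →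
    ∀ z ∈ disc, ∀ w ∈ disc, δ (h z) (h w) ≤ poincareDist z w

/-- The orbifold Kobayashi pseudodistance on `X \ Δ₁`: the largest pseudodistance for which all
orbifold morphisms from the unit disc to `(X/Δ)` are distance decreasing, i.e. the pointwise
supremum of all such pseudodistances (which is again one). The supremum is taken in `[0, ∞]`, so
that no boundedness is presupposed. -/
def kobayashiDist (Δ : OrbifoldDivisor X) (x y : X) : ℝ≥0∞ :=
  ⨆ (δ : X → X → ℝ) (_ : IsDiscDecreasing Δ δ), ENNReal.ofReal (δ x y)

/-- `(X/Δ)` is orbifold hyperbolic: its orbifold Kobayashi pseudodistance is a distance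
on `X \ Δ₁`. -/
def IsOrbifoldHyperbolic (Δ : OrbifoldDivisor X) : Prop :=
  ∀ x ∈ Δ.infPartᶜ, ∀ y ∈ Δ.infPartᶜ, kobayashiDist Δ x y = 0 → x = y

end Kobayashi

section Metric

variable (X : Type*) [TopologicalSpace X] [ChartedSpace ℂ X] [IsManifold 𝓘(ℂ) 1 X]

/-- A (continuous) hermitian metric on `X`: a positive definite hermitian form on every tangent
space, whose quadratic form is continuous on the total space of the tangent bundle. -/
structure HermitianMetric where
  form : ∀ x : X, TangentSpace 𝓘(ℂ) x →ₗ⋆[ℂ] TangentSpace 𝓘(ℂ) x →ₗ[ℂ] ℂ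
  conj_symm : ∀ x v w, conj (form x v w) = form x w v
  pos : ∀ x v, v ≠ 0 → 0 < (form x v v).re
  continuous_form : Continuous fun v : TangentBundle 𝓘(ℂ) X => (form v.1 v.2 v.2).re

variable {X}

/-- The length of a tangent vector. -/
def HermitianMetric.norm (h : HermitianMetric X) (x : X) (v : TangentSpace 𝓘(ℂ) x) : ℝ :=
  Real.sqrt (h.form x v v).re

/-- The derivative of `f : ℂ → X` is bounded, with respect to the euclidean metric on `ℂ` and any
hermitian metric on `X` (if `X` is compact, all of these are comparable). -/
def HasBoundedDerivative (f : ℂ → X) : Prop :=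
  ∀ h : HermitianMetric X, ∃ C : ℝ, ∀ z : ℂ,
    h.norm (f z) (mfderiv 𝓘(ℂ) 𝓘(ℂ) f z (1 : ℂ)) ≤ C

end Metric

end Orbicurve

end

/-! This is Brody's dichotomy, according to whether the derivative at the centre of orbifold discs
is bounded. Discs whose image lies in `|Δ|` are admitted (`IsOrbifoldHolomorphicOn`), so that the
class is stable under rescaling and under limits. On compact `X`, size is measured by `speed`, the
derivative read in one of finitely many charts.

If the speed at `0` is at most `M`, rescaling discs centred at `w` gives speed at most `M / (1 -
‖w‖)` everywhere. A tent function at `x` then varies along every orbifold disc by at most a constant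
times the Poincaré distance. After scaling, its differences form a pseudodistance competing in the
supremum that defines `kobayashiDist`, and this one separates `x` from every other point
(`isOrbifoldHyperbolic_of_speed_le`).

If the speed is unbounded, reparametrization gives maps on discs of radius tending to infinity with
speed `1` at `0` and at most `4` everywhere (`exists_rescaled`). A limit along an ultrafilter is
entire, nonconstant and of bounded derivative (`exists_entire`). By Hurwitz, finite multiplicity
conditions survive in the limit (`le_analyticOrderAt_of_tendstoLocallyUniformlyOn`). Finally, a
nonconstant entire map cannot land in the finite set `|Δ|`, so the limit is an orbifold morphism. -/

namespace Orbicurve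
open Filter Metric Set

/-! ### Locally uniform limits, Hurwitz and vanishing orders -/

/-- Pointwise convergence of uniformly Lipschitz functions is locally uniform. -/
lemma tendstoLocallyUniformlyOn_of_lipschitz {ι : Type*} {l : Filter ι} [l.NeBot] {U : Set ℂ}
    {F : ι → ℂ → ℂ} {f : ℂ → ℂ} {L : ℝ} (hL : 0 < L)
    (hF : ∀ᶠ n in l, ∀ z ∈ U, ∀ w ∈ U, ‖F n z - F n w‖ ≤ L * ‖z - w‖)
    (hf : ∀ z ∈ U, Tendsto (fun n => F n z) l (𝓝 (f z))) :
    TendstoLocallyUniformlyOn F f l U := by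
  have hlim : ∀ z ∈ U, ∀ w ∈ U, ‖f z - f w‖ ≤ L * ‖z - w‖ := fun z hz w hw =>
    le_of_tendsto ((hf z hz).sub (hf w hw)).norm (hF.mono fun n hn => hn z hz w hw)
  rw [Metric.tendstoLocallyUniformlyOn_iff]
  intro ε hε w hw
  refine ⟨U ∩ ball w (ε / (3 * L)),
    inter_mem_nhdsWithin _ (ball_mem_nhds _ (by positivity)), ?_⟩
  have h1 := (Metric.tendsto_nhds.1 (hf w hw)) (ε / 3) (by positivity)
  filter_upwards [hF, h1] with n hn hnw z hz
  have hzw : L * ‖z - w‖ < ε / 3 := by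
    have := hz.2
    rw [mem_ball, dist_eq_norm, lt_div_iff₀ (by positivity)] at this
    linarith
  have a := hn z hz.1 w hw
  have b := hlim z hz.1 w hw
  rw [dist_eq_norm] at hnw ⊢
  calc ‖f z - F n z‖ = ‖(f z - f w) - (F n w - f w) - (F n z - F n w)‖ := by ring_nf
    _ ≤ ‖f z - f w‖ + ‖F n w - f w‖ + ‖F n z - F n w‖ :=
      (norm_sub_le _ _).trans (add_le_add (norm_sub_le _ _) le_rfl)
    _ < ε := by linarith

/-- Hurwitz: near an isolated zero of a locally uniform limit there are zeros of the approximants. -/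
lemma exists_zero_of_tendstoLocallyUniformlyOn {ι : Type*} {l : Filter ι} [l.NeBot] {U : Set ℂ}
    (hU : IsOpen U) {F : ι → ℂ → ℂ} {f : ℂ → ℂ}
    (hF : ∀ᶠ n in l, DifferentiableOn ℂ (F n) U) (h : TendstoLocallyUniformlyOn F f l U)
    {z₀ : ℂ} (hz₀ : z₀ ∈ U) (h0 : f z₀ = 0) (hne : ∀ᶠ z in 𝓝[≠] z₀, f z ≠ 0)
    {V : Set ℂ} (hV : V ∈ 𝓝 z₀) :
    ∀ᶠ n in l, ∃ z ∈ V, F n z = 0 := by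
  have hf : DifferentiableOn ℂ f U := h.differentiableOn hF hU
  have hev : ∀ᶠ z in 𝓝 z₀, z ∈ V ∧ z ∈ U ∧ (z ≠ z₀ → f z ≠ 0) :=
    Eventually.and hV (Eventually.and (hU.mem_nhds hz₀) (eventually_nhdsWithin_iff.1 hne))
  obtain ⟨r, hr, hball⟩ := Metric.nhds_basis_closedBall.eventually_iff.1 hev
  have hsub : closedBall z₀ r ⊆ U := fun z hz => (hball hz).2.1
  have hcomp : IsCompact (sphere z₀ r) := isCompact_sphere _ _
  have hfs : ContinuousOn (fun z => ‖f z‖) (sphere z₀ r) :=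
    (hf.continuousOn.mono (sphere_subset_closedBall.trans hsub)).norm
  obtain ⟨c, hc, hcmin⟩ := hcomp.exists_isMinOn
    (NormedSpace.sphere_nonempty.2 hr.le) hfs
  set m := ‖f c‖ with hm
  have hm0 : 0 < m := norm_pos_iff.2
    ((hball (sphere_subset_closedBall hc)).2.2 (ne_of_mem_sphere hc hr.ne'))
  have hunif := (tendstoLocallyUniformlyOn_iff_forall_isCompact hU).1 h _ hsub
    (isCompact_closedBall z₀ r)
  rw [Metric.tendstoUniformlyOn_iff] at hunif
  filter_upwards [hF, hunif (m / 3) (by positivity)] with n hn hun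
  -- Maximum principle for `1 / F n`: on the circle `‖F n‖ ≥ 2m/3`, so without zeros the same bound
  -- would hold at `z₀`, where `‖F n‖ < m/3`.
  by_contra! hcon
  have hnz : ∀ z ∈ closedBall z₀ r, F n z ≠ 0 := fun z hz => hcon z (hball hz).1
  have hd : DifferentiableOn ℂ (fun z => (F n z)⁻¹) (closedBall z₀ r) :=
    (hn.mono hsub).inv hnz
  have hdc : DiffContOnCl ℂ (fun z => (F n z)⁻¹) (ball z₀ r) := by
    refine DifferentiableOn.diffContOnCl ?_
    rwa [closure_ball _ hr.ne']
  have hbd : ∀ z ∈ frontier (ball z₀ r), ‖(F n z)⁻¹‖ ≤ (2 * m / 3)⁻¹ := by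
    intro z hz
    rw [frontier_ball _ hr.ne'] at hz
    have h1 : m ≤ ‖f z‖ := hcmin hz
    have h2 := hun z (sphere_subset_closedBall hz)
    rw [dist_eq_norm] at h2
    have h3 : ‖f z‖ - ‖F n z‖ ≤ ‖f z - F n z‖ := norm_sub_norm_le _ _
    rw [norm_inv]
    exact inv_anti₀ (by positivity) (by linarith)
  have hz := Complex.norm_le_of_forall_mem_frontier_norm_le isBounded_ball hdc hbd
    (subset_closure (mem_ball_self hr))
  have h2 := hun z₀ (mem_closedBall_self hr.le)
  rw [h0, dist_zero_left] at h2
  rw [norm_inv] at hz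
  have h4 := (inv_le_inv₀ (norm_pos_iff.2 (hnz z₀ (mem_closedBall_self hr.le)))
    (by positivity)).1 hz
  linarith

lemma tendstoLocallyUniformlyOn_iteratedDeriv {ι : Type*} {l : Filter ι} {U : Set ℂ}
    (hU : IsOpen U) {F : ι → ℂ → ℂ} {f : ℂ → ℂ}
    (hF : ∀ᶠ n in l, DifferentiableOn ℂ (F n) U) (h : TendstoLocallyUniformlyOn F f l U) (k : ℕ) :
    TendstoLocallyUniformlyOn (fun n => iteratedDeriv k (F n)) (iteratedDeriv k f) l U := by
  have key : ∀ k : ℕ, (∀ᶠ n in l, DifferentiableOn ℂ (iteratedDeriv k (F n)) U) ∧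
      TendstoLocallyUniformlyOn (fun n => iteratedDeriv k (F n)) (iteratedDeriv k f) l U := by
    intro k
    induction k with
    | zero => simpa [iteratedDeriv_zero] using ⟨hF, h⟩
    | succ k ih =>
      simp only [iteratedDeriv_succ]
      exact ⟨ih.1.mono fun n hn => hn.deriv hU, ih.2.deriv ih.1 hU⟩
  exact (key k).2

/-- Vanishing to order at least `m` at all zeros passes to locally uniform limits. -/
lemma le_analyticOrderAt_of_tendstoLocallyUniformlyOn {ι : Type*} {l : Filter ι} [l.NeBot]
    {U : Set ℂ} (hU : IsOpen U) {F : ι → ℂ → ℂ} {f : ℂ → ℂ}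
    (hF : ∀ᶠ n in l, DifferentiableOn ℂ (F n) U) (h : TendstoLocallyUniformlyOn F f l U)
    {z₀ : ℂ} (hz₀ : z₀ ∈ U) (h0 : f z₀ = 0) {m : ℕ}
    (hm : ∀ᶠ n in l, ∀ z ∈ U, F n z = 0 → (m : ℕ∞) ≤ analyticOrderAt (F n) z) :
    (m : ℕ∞) ≤ analyticOrderAt f z₀ := by
  have hf : DifferentiableOn ℂ f U := h.differentiableOn hF hU
  have hfa : AnalyticAt ℂ f z₀ := hf.analyticAt (hU.mem_nhds hz₀)
  rcases hfa.eventually_eq_zero_or_eventually_ne_zero with hz | hne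
  · rw [analyticOrderAt_eq_top.2 hz]; exact le_top
  rw [natCast_le_analyticOrderAt_iff_iteratedDeriv_eq_zero hfa]
  intro k hk
  by_contra hcon
  have hconv := tendstoLocallyUniformlyOn_iteratedDeriv hU hF h k
  have hcont : ContinuousAt (iteratedDeriv k f) z₀ := by
    rw [iteratedDeriv_eq_iterate]; exact (hfa.iterated_deriv k).continuousAt
  set a := ‖iteratedDeriv k f z₀‖ with ha
  have ha0 : 0 < a := norm_pos_iff.2 hcon
  rw [Metric.tendstoLocallyUniformlyOn_iff] at hconv
  obtain ⟨V, hV, hVn⟩ := hconv (a / 2) (by positivity) z₀ hz₀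
  rw [hU.nhdsWithin_eq hz₀] at hV
  have hW : {z | z ∈ V ∧ z ∈ U ∧ dist (iteratedDeriv k f z) (iteratedDeriv k f z₀) < a / 2}
      ∈ 𝓝 z₀ :=
    Eventually.and hV (Eventually.and (hU.mem_nhds hz₀)
      (Metric.tendsto_nhds.1 hcont (a / 2) (by positivity)))
  -- At a zero `z` of `F n` close to `z₀` the `k`-th derivative of `F n` vanishes, although it is
  -- within `a/2` of that of `f` at `z`, itself within `a/2` of a number of norm `a`.
  obtain ⟨n, hnF, hnm, hnV, z, ⟨hzV, hzU, hzd⟩, hz⟩ := (hF.and (hm.and (hVn.and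
    (exists_zero_of_tendstoLocallyUniformlyOn hU hF h hz₀ h0 hne hW)))).exists
  have h1 := (natCast_le_analyticOrderAt_iff_iteratedDeriv_eq_zero
    (hnF.analyticAt (hU.mem_nhds hzU))).1 (hnm z hzU hz) k hk
  have h2 := hnV z hzV
  rw [h1, dist_zero_right] at h2
  rw [dist_eq_norm, norm_sub_rev] at hzd
  have h3 : a - ‖iteratedDeriv k f z‖ ≤ _ := norm_sub_norm_le _ _
  linarith

/-! ### Elementary bounds for the Poincaré distance -/

lemma norm_sub_lt_norm_one_sub {z w : ℂ} (hz : z ∈ disc) (hw : w ∈ disc) :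
    ‖z - w‖ < ‖1 - conj w * z‖ := by
  have hz' : ‖z‖ < 1 := by simpa using hz
  have hw' : ‖w‖ < 1 := by simpa using hw
  have key : ‖1 - conj w * z‖ ^ 2 - ‖z - w‖ ^ 2 = (1 - ‖z‖ ^ 2) * (1 - ‖w‖ ^ 2) := by
    simp only [Complex.sq_norm, Complex.normSq_apply, Complex.sub_re, Complex.sub_im,
      Complex.mul_re, Complex.mul_im, Complex.conj_re, Complex.conj_im, Complex.one_re,
      Complex.one_im]
    ring
  have : 0 < (1 - ‖z‖ ^ 2) * (1 - ‖w‖ ^ 2) := by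
    have := norm_nonneg z
    have := norm_nonneg w
    apply mul_pos <;> nlinarith
  exact lt_of_pow_lt_pow_left₀ 2 (norm_nonneg _) (by linarith)

/-- With `t` the left side, the distance is `log ((1 + t) / (1 - t))`, and `log x ≥ 1 - 1/x` bounds
it below by `2t / (1 + t) ≥ t`. -/
lemma le_poincareDist {z w : ℂ} (hz : z ∈ disc) (hw : w ∈ disc) :
    ‖z - w‖ / ‖1 - conj w * z‖ ≤ poincareDist z w := by
  have h := norm_sub_lt_norm_one_sub hz hw
  have hpos : 0 < ‖1 - conj w * z‖ := (norm_nonneg _).trans_lt h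
  rw [poincareDist]
  set t := ‖z - w‖ / ‖1 - conj w * z‖ with ht
  have ht0 : 0 ≤ t := by positivity
  have ht1 : t < 1 := (div_lt_one hpos).2 h
  rw [Real.artanh_eq_half_log ⟨by linarith, ht1.le⟩]
  have h1 : 0 < (1 + t) / (1 - t) := div_pos (by linarith) (by linarith)
  have h2 := Real.one_sub_inv_le_log_of_pos h1
  rw [inv_div] at h2
  have h3 : t ≤ 1 - (1 - t) / (1 + t) := by
    rw [le_sub_iff_add_le, ← le_sub_iff_add_le', div_le_iff₀ (by linarith)]
    nlinarith
  linarith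

/-- Together with `le_poincareDist`, this compares the Poincaré distance from below with `‖z - w‖`
in units of the distance `1 - ‖w‖` to the boundary. -/
lemma norm_one_sub_conj_mul_le {z w : ℂ} (hw : w ∈ disc) :
    ‖1 - conj w * z‖ ≤ 2 * (1 - ‖w‖) + ‖z - w‖ := by
  have hw' : ‖w‖ < 1 := by simpa using hw
  have h0 := norm_nonneg w
  have e : 1 - conj w * z = (1 - conj w * w) - conj w * (z - w) := by ring
  have h1 : ‖1 - conj w * w‖ = 1 - ‖w‖ ^ 2 := by
    rw [← Complex.normSq_eq_conj_mul_self, Complex.normSq_eq_norm_sq]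
    rw [← Complex.ofReal_one, ← Complex.ofReal_sub, Complex.norm_real, Real.norm_eq_abs,
      abs_of_nonneg (by nlinarith)]
  rw [e]
  refine (norm_sub_le _ _).trans ?_
  rw [h1, norm_mul, Complex.norm_conj]
  have := norm_nonneg (z - w)
  nlinarith

lemma poincareDist_comm (z w : ℂ) : poincareDist z w = poincareDist w z := by
  rw [poincareDist, poincareDist, norm_sub_rev z w]
  congr 3
  rw [← Complex.norm_conj]
  simp [mul_comm]

end Orbicurve

/-! ### Coordinate discs and the speed of a map -/

namespace Orbicurve
open Filter Metric Set

section Charts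

variable {X : Type*} [TopologicalSpace X] [ChartedSpace ℂ X]

lemma exists_closedBall_subset_target (p : X) :
    ∃ s : ℝ, 0 < s ∧ closedBall (chartAt ℂ p p) (2 * s) ⊆ (chartAt ℂ p).target := by
  obtain ⟨r, hr, h⟩ := Metric.nhds_basis_closedBall.mem_iff.1
    ((chartAt ℂ p).open_target.mem_nhds (mem_chart_target ℂ p))
  exact ⟨r / 2, by positivity, by rwa [mul_div_cancel₀ _ two_ne_zero]⟩

/-- A radius such that twice the disc of this radius lies in the image of the chart at `p`. -/
noncomputable def chartRadius (p : X) : ℝ := (exists_closedBall_subset_target p).choose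

lemma chartRadius_pos (p : X) : 0 < chartRadius p :=
  (exists_closedBall_subset_target p).choose_spec.1

lemma closedBall_chartRadius_subset (p : X) :
    closedBall (chartAt ℂ p p) (2 * chartRadius p) ⊆ (chartAt ℂ p).target :=
  (exists_closedBall_subset_target p).choose_spec.2

/-- The open coordinate disc of radius `t` around `p`. -/
def coordDisc (p : X) (t : ℝ) : Set X :=
  (chartAt ℂ p).source ∩ chartAt ℂ p ⁻¹' ball (chartAt ℂ p p) t

/-- The closed coordinate disc around `p` of twice the chart radius. -/
def coordCompact (p : X) : Set X :=
  (chartAt ℂ p).symm '' closedBall (chartAt ℂ p p) (2 * chartRadius p)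

lemma isOpen_coordDisc (p : X) (t : ℝ) : IsOpen (coordDisc p t) :=
  (chartAt ℂ p).isOpen_inter_preimage isOpen_ball

lemma mem_coordDisc (p : X) : p ∈ coordDisc p (chartRadius p) :=
  ⟨mem_chart_source ℂ p, mem_ball_self (chartRadius_pos p)⟩

lemma isCompact_coordCompact (p : X) : IsCompact (coordCompact p) :=
  (isCompact_closedBall _ _).image_of_continuousOn
    ((chartAt ℂ p).continuousOn_symm.mono (closedBall_chartRadius_subset p))

lemma coordCompact_subset_source (p : X) : coordCompact p ⊆ (chartAt ℂ p).source := by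
  rintro _ ⟨z, hz, rfl⟩
  exact (chartAt ℂ p).map_target (closedBall_chartRadius_subset p hz)

lemma coordDisc_two_subset (p : X) : coordDisc p (2 * chartRadius p) ⊆ coordCompact p :=
  fun q hq => ⟨chartAt ℂ p q, ball_subset_closedBall hq.2, (chartAt ℂ p).left_inv hq.1⟩

lemma coordDisc_subset_coordDisc_two (p : X) :
    coordDisc p (chartRadius p) ⊆ coordDisc p (2 * chartRadius p) :=
  fun _ hq => ⟨hq.1, ball_subset_ball (by linarith [chartRadius_pos p]) hq.2⟩

lemma coordDisc_subset (p : X) : coordDisc p (chartRadius p) ⊆ coordCompact p :=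
  (coordDisc_subset_coordDisc_two p).trans (coordDisc_two_subset p)

/-- The size of the derivative of `h` at `z` in the chart at `p`. -/
noncomputable def chartSpeed (p : X) (h : ℂ → X) (z : ℂ) : ℝ :=
  ‖deriv (fun w => chartAt ℂ p (h w)) z‖

/-- A finite subcover by coordinate discs. The choice `ι` is in general discontinuous, but its
finite range lets constants depending on the chart be maximized. -/
lemma exists_finite_index (X : Type*) [TopologicalSpace X] [ChartedSpace ℂ X] [CompactSpace X] :
    ∃ ι : X → X, (range ι).Finite ∧ ∀ q, q ∈ coordDisc (ι q) (chartRadius (ι q)) := by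
  obtain ⟨t, ht⟩ := CompactSpace.elim_nhds_subcover
    (fun p : X => coordDisc p (chartRadius p))
    (fun p => (isOpen_coordDisc p _).mem_nhds (mem_coordDisc p))
  have h : ∀ q : X, ∃ p ∈ t, q ∈ coordDisc p (chartRadius p) := fun q => by
    have : q ∈ ⋃ p ∈ t, coordDisc p (chartRadius p) := ht ▸ mem_univ q
    simpa using this
  choose ι hι hq using h
  exact ⟨ι, t.finite_toSet.subset (range_subset_iff.2 hι), hq⟩

variable [IsManifold 𝓘(ℂ) 1 X]

lemma differentiableAt_chartAt_comp {p : X} {h : ℂ → X} {z : ℂ}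
    (hh : MDifferentiableAt 𝓘(ℂ) 𝓘(ℂ) h z) (hz : h z ∈ (chartAt ℂ p).source) :
    DifferentiableAt ℂ (fun w => chartAt ℂ p (h w)) z := by
  rw [← mdifferentiableAt_iff_differentiableAt]
  exact (mdifferentiableAt_atlas (chart_mem_atlas ℂ p) hz).comp z hh

lemma differentiableOn_transition (a b : X) :
    DifferentiableOn ℂ (fun w => chartAt ℂ a ((chartAt ℂ b).symm w))
      ((chartAt ℂ b).symm.trans (chartAt ℂ a)).source := by
  intro w hw
  rw [OpenPartialHomeomorph.trans_source, OpenPartialHomeomorph.symm_source] at hw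
  exact (differentiableAt_chartAt_comp
    (mdifferentiableAt_atlas_symm (chart_mem_atlas ℂ b) hw.1) hw.2).differentiableWithinAt

/-- By the chain rule the two speeds differ by the derivative of the transition map, which is
bounded on the compact overlap. -/
lemma exists_chartSpeed_le [T2Space X] (a b : X) :
    ∃ C : ℝ, ∀ (h : ℂ → X) (z : ℂ), MDifferentiableAt 𝓘(ℂ) 𝓘(ℂ) h z →
      h z ∈ coordCompact a → h z ∈ coordCompact b → chartSpeed a h z ≤ C * chartSpeed b h z := by
  set τ := (chartAt ℂ b).symm.trans (chartAt ℂ a) with hτ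
  set T : ℂ → ℂ := fun w => chartAt ℂ a ((chartAt ℂ b).symm w) with hT
  have hd : DifferentiableOn ℂ T τ.source := differentiableOn_transition a b
  set K := coordCompact a ∩ coordCompact b with hK
  have hKc : IsCompact (chartAt ℂ b '' K) :=
    ((isCompact_coordCompact a).inter (isCompact_coordCompact b)).image_of_continuousOn
      ((chartAt ℂ b).continuousOn.mono
        (inter_subset_right.trans (coordCompact_subset_source b)))
  have hKs : chartAt ℂ b '' K ⊆ τ.source := by
    rintro _ ⟨q, hq, rfl⟩
    have hb := coordCompact_subset_source b hq.2
    rw [hτ, OpenPartialHomeomorph.trans_source, OpenPartialHomeomorph.symm_source]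
    refine ⟨(chartAt ℂ b).map_source hb, ?_⟩
    rw [mem_preimage, (chartAt ℂ b).left_inv hb]
    exact coordCompact_subset_source a hq.1
  obtain ⟨C, hC⟩ := hKc.exists_bound_of_continuousOn
    ((hd.deriv τ.open_source).continuousOn.mono hKs)
  refine ⟨C, fun h z hh ha hb => ?_⟩
  have hbs := coordCompact_subset_source b hb
  have hmem : chartAt ℂ b (h z) ∈ chartAt ℂ b '' K := ⟨h z, ⟨ha, hb⟩, rfl⟩
  have hTd : DifferentiableAt ℂ T (chartAt ℂ b (h z)) :=
    hd.differentiableAt (τ.open_source.mem_nhds (hKs hmem))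
  have hbd := differentiableAt_chartAt_comp hh hbs
  have hev : (fun w => chartAt ℂ a (h w)) =ᶠ[𝓝 z] T ∘ fun w => chartAt ℂ b (h w) := by
    filter_upwards [hh.continuousAt.preimage_mem_nhds
      ((chartAt ℂ b).open_source.mem_nhds hbs)] with w hw
    simp only [hT, Function.comp]
    rw [(chartAt ℂ b).left_inv hw]
  rw [chartSpeed, chartSpeed, hev.deriv_eq, deriv_comp z hTd hbd, norm_mul]
  exact mul_le_mul_of_nonneg_right (hC _ hmem) (norm_nonneg _)

/-- The size of the derivative of `h` at `z`, in the chart selected by `ι` at the point `h z`. -/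
noncomputable def speed {X : Type*} [TopologicalSpace X] [ChartedSpace ℂ X]
    (ι : X → X) (h : ℂ → X) (z : ℂ) : ℝ :=
  chartSpeed (ι (h z)) h z

lemma exists_speed_comparison [T2Space X] {ι : X → X} (hfin : (range ι).Finite)
    (hι : ∀ q, q ∈ coordDisc (ι q) (chartRadius (ι q))) (p : X) :
    ∃ C : ℝ, 0 < C ∧ ∀ (h : ℂ → X) (z : ℂ), MDifferentiableAt 𝓘(ℂ) 𝓘(ℂ) h z →
      h z ∈ coordCompact p →
        chartSpeed p h z ≤ C * speed ι h z ∧ speed ι h z ≤ C * chartSpeed p h z := by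
  choose c hc using exists_chartSpeed_le (X := X)
  obtain ⟨C₁, hC₁⟩ := (hfin.image fun a => c p a).bddAbove
  obtain ⟨C₂, hC₂⟩ := (hfin.image fun a => c a p).bddAbove
  refine ⟨max 1 (max C₁ C₂), by positivity, fun h z hh hz => ?_⟩
  have hmem := coordDisc_subset _ (hι (h z))
  have h1 : c p (ι (h z)) ≤ C₁ := hC₁ ⟨_, mem_range_self _, rfl⟩
  have h2 : c (ι (h z)) p ≤ C₂ := hC₂ ⟨_, mem_range_self _, rfl⟩
  constructor
  · exact (hc p (ι (h z)) h z hh hz hmem).trans (mul_le_mul_of_nonneg_right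
      (h1.trans ((le_max_left _ _).trans (le_max_right _ _))) (norm_nonneg _))
  · exact (hc (ι (h z)) p h z hh hmem hz).trans (mul_le_mul_of_nonneg_right
      (h2.trans ((le_max_right _ _).trans (le_max_right _ _))) (norm_nonneg _))

lemma norm_chartAt_sub_le {p : X} {h : ℂ → X} {S : Set ℂ} (hS : Convex ℝ S) {L : ℝ}
    (hh : ∀ z ∈ S, MDifferentiableAt 𝓘(ℂ) 𝓘(ℂ) h z)
    (hK : ∀ z ∈ S, h z ∈ (chartAt ℂ p).source) (hL : ∀ z ∈ S, chartSpeed p h z ≤ L)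
    {z w : ℂ} (hz : z ∈ S) (hw : w ∈ S) :
    ‖chartAt ℂ p (h z) - chartAt ℂ p (h w)‖ ≤ L * ‖z - w‖ :=
  hS.norm_image_sub_le_of_norm_hasDerivWithin_le (f := fun w => chartAt ℂ p (h w))
    (fun x hx => (differentiableAt_chartAt_comp (hh x hx) (hK x hx)).hasDerivAt.hasDerivWithinAt)
    hL hw hz

/-- A map of small speed on a disc stays in the coordinate disc around the image of the centre. -/
lemma exists_mapsTo_coordCompact [T2Space X] {ι : X → X} (hfin : (range ι).Finite)
    (hι : ∀ q, q ∈ coordDisc (ι q) (chartRadius (ι q))) (p : X) :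
    ∃ ρ C : ℝ, 0 < ρ ∧ 0 < C ∧ ∀ (h : ℂ → X) (z₀ : ℂ) (r B : ℝ), r * B ≤ ρ →
      (∀ z ∈ ball z₀ r, MDifferentiableAt 𝓘(ℂ) 𝓘(ℂ) h z) →
      (∀ z ∈ ball z₀ r, speed ι h z ≤ B) → h z₀ ∈ coordDisc p (chartRadius p) →
      ∀ z ∈ ball z₀ r, h z ∈ coordCompact p ∧ chartSpeed p h z ≤ C * B := by
  obtain ⟨C, hC0, hC⟩ := exists_speed_comparison hfin hι p
  have hs := chartRadius_pos p
  -- With this `ρ`, the displacement in the chart is at most `C * B * r ≤ chartRadius p`, too little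
  -- to get from the disc of radius `chartRadius p` out of the one of twice that radius.
  refine ⟨chartRadius p / C, C, by positivity, hC0, fun h z₀ r B hrB hh hB hz₀ => ?_⟩
  have hin : ∀ z ∈ ball z₀ r, h z ∈ coordDisc p (2 * chartRadius p) := by
    intro z hz
    by_contra hbad
    have hr : 0 < r := pos_of_mem_ball hz
    have hB0 : 0 ≤ B := (norm_nonneg _).trans (hB z hz)
    set γ : ℝ → ℂ := fun t => z₀ + t • (z - z₀) with hγ
    have hγc : Continuous γ := by fun_prop
    have hγb : ∀ t ∈ Icc (0 : ℝ) 1, γ t ∈ ball z₀ r := by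
      intro t ht
      rw [mem_ball, dist_eq_norm] at hz ⊢
      simp only [hγ, add_sub_cancel_left, norm_smul, Real.norm_eq_abs, abs_of_nonneg ht.1]
      exact (mul_le_of_le_one_left (norm_nonneg _) ht.2).trans_lt hz
    have hcont : ContinuousOn (fun t => h (γ t)) (Icc 0 1) := fun t ht =>
      ((hh _ (hγb t ht)).continuousAt.comp hγc.continuousAt).continuousWithinAt
    set bad : Set ℝ := Icc 0 1 ∩ (fun t => h (γ t)) ⁻¹' (coordDisc p (2 * chartRadius p))ᶜ
      with hbadset
    have hclosed : IsClosed bad :=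
      hcont.preimage_isClosed_of_isClosed isClosed_Icc (isOpen_coordDisc p _).isClosed_compl
    have hcomp : IsCompact bad := isCompact_Icc.of_isClosed_subset hclosed inter_subset_left
    have h1 : (1 : ℝ) ∈ bad := ⟨⟨zero_le_one, le_rfl⟩, by simpa [hγ] using hbad⟩
    -- First exit time along the radius from `z₀` to `z`. Up to and including `t₀` the path stays in
    -- the compact disc, where the speed comparison holds.
    obtain ⟨t₀, ht₀, hmin⟩ := hcomp.exists_isLeast ⟨1, h1⟩
    have hgood : ∀ t ∈ Ico 0 t₀, h (γ t) ∈ coordCompact p := by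
      intro t ht
      by_contra hcon
      have : t ∈ bad := ⟨⟨ht.1, ht.2.le.trans ht₀.1.2⟩,
        fun h' => hcon (coordDisc_two_subset p h')⟩
      exact absurd (hmin this) (not_le.2 ht.2)
    have ht₀pos : 0 < t₀ := by
      rcases ht₀.1.1.eq_or_lt with h0 | h0
      · refine absurd ?_ ht₀.2
        rw [← h0]
        simpa [hγ] using coordDisc_subset_coordDisc_two p hz₀
      · exact h0
    have hend : h (γ t₀) ∈ coordCompact p := by
      have hcl : t₀ ∈ closure (Ico 0 t₀) := by
        rw [closure_Ico ht₀pos.ne]; exact ⟨ht₀pos.le, le_rfl⟩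
      have := ((hh _ (hγb t₀ ht₀.1)).continuousAt.comp
        (f := γ) hγc.continuousAt).continuousWithinAt.mem_closure hcl
        (show MapsTo (h ∘ γ) (Ico 0 t₀) (coordCompact p) from hgood)
      rwa [(isCompact_coordCompact p).isClosed.closure_eq] at this
    have hseg : ∀ w ∈ segment ℝ (γ 0) (γ t₀), w ∈ ball z₀ r ∧ h w ∈ coordCompact p := by
      intro w hw
      rw [segment_eq_image'] at hw
      obtain ⟨θ, hθ, rfl⟩ := hw
      have e : γ 0 + θ • (γ t₀ - γ 0) = γ (θ * t₀) := by
        simp [hγ]; ring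
      simp only [e]
      have hle : θ * t₀ ≤ t₀ := mul_le_of_le_one_left ht₀pos.le hθ.2
      have h0 : 0 ≤ θ * t₀ := mul_nonneg hθ.1 ht₀pos.le
      refine ⟨hγb _ ⟨h0, hle.trans ht₀.1.2⟩, ?_⟩
      rcases hle.eq_or_lt with h' | h'
      · rwa [h']
      · exact hgood _ ⟨h0, h'⟩
    have hle := norm_chartAt_sub_le (p := p) (h := h) (L := C * B)
      (convex_segment (𝕜 := ℝ) (γ 0) (γ t₀))
      (fun w hw => hh w (hseg w hw).1)
      (fun w hw => coordCompact_subset_source p (hseg w hw).2)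
      (fun w hw => ((hC h w (hh w (hseg w hw).1) (hseg w hw).2).1).trans
        (mul_le_mul_of_nonneg_left (hB w (hseg w hw).1) hC0.le))
      (right_mem_segment ℝ _ _) (left_mem_segment ℝ _ _)
    have hγ0 : γ 0 = z₀ := by simp [hγ]
    rw [hγ0] at hle
    have hlt : ‖γ t₀ - z₀‖ ≤ r := by
      rw [← dist_eq_norm]; exact (hγb t₀ ht₀.1).le
    have hz₀' := hz₀.2
    rw [mem_preimage, mem_ball, dist_eq_norm] at hz₀'
    have hfin : C * B * ‖γ t₀ - z₀‖ ≤ chartRadius p := by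
      rw [le_div_iff₀ hC0] at hrB
      nlinarith [mul_nonneg hC0.le hB0]
    refine ht₀.2 ⟨coordCompact_subset_source p hend, ?_⟩
    rw [mem_preimage, mem_ball, dist_eq_norm]
    calc ‖chartAt ℂ p (h (γ t₀)) - chartAt ℂ p p‖
        ≤ ‖chartAt ℂ p (h (γ t₀)) - chartAt ℂ p (h z₀)‖
          + ‖chartAt ℂ p (h z₀) - chartAt ℂ p p‖ := norm_sub_le_norm_sub_add_norm_sub _ _ _
      _ < 2 * chartRadius p := by linarith
  intro z hz
  have hzK := coordDisc_two_subset p (hin z hz)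
  exact ⟨hzK, (hC h z (hh z hz) hzK).1.trans (mul_le_mul_of_nonneg_left (hB z hz) hC0.le)⟩

end Charts

end Orbicurve

/-! ### Orbifold holomorphic maps; bounded speed implies hyperbolicity -/

namespace Orbicurve
open Filter Metric Set

variable {X : Type*} [TopologicalSpace X] [ChartedSpace ℂ X]

/-- `h` is holomorphic on `S` and pulls the points of `|Δ|` back with at least their multiplicity;
unlike for orbifold morphisms, the image of `h` may lie in `|Δ|`. -/
structure IsOrbifoldHolomorphicOn (Δ : OrbifoldDivisor X) (h : ℂ → X) (S : Set ℂ) : Prop where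
  mdifferentiableAt : ∀ z ∈ S, MDifferentiableAt 𝓘(ℂ) 𝓘(ℂ) h z
  mult_le : ∀ z ∈ S, h z ∈ Δ.support → Δ.mult (h z) ≤ pullbackMult h (h z) z

lemma IsDiscMorphism.isOrbifoldHolomorphicOn {Δ : OrbifoldDivisor X} {h : ℂ → X}
    (hh : IsDiscMorphism Δ h) : IsOrbifoldHolomorphicOn Δ h disc where
  mdifferentiableAt := fun z hz => (hh.holo z hz).mdifferentiableAt (isOpen_ball.mem_nhds hz)
  mult_le := hh.mult_le

/-- Vanishing orders multiply under composition, and the inner factor has order at least `1`. -/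
lemma IsOrbifoldHolomorphicOn.comp {Δ : OrbifoldDivisor X} {h : ℂ → X} {S S' : Set ℂ}
    (hh : IsOrbifoldHolomorphicOn Δ h S) {α : ℂ → ℂ} (hα : ∀ z ∈ S', AnalyticAt ℂ α z)
    (hmaps : MapsTo α S' S) : IsOrbifoldHolomorphicOn Δ (fun z => h (α z)) S' where
  mdifferentiableAt := fun z hz => (hh.mdifferentiableAt _ (hmaps hz)).comp z
    (hα z hz).differentiableAt.mdifferentiableAt
  mult_le := fun z hz hsupp => by
    have h1 := hh.mult_le _ (hmaps hz) hsupp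
    -- `analyticOrderAt` is `0` for non-analytic functions, so a nonzero order also supplies
    -- analyticity.
    have h0 : pullbackMult h (h (α z)) (α z) ≠ 0 :=
      (zero_lt_one.trans_le ((Δ.one_le_mult _).trans h1)).ne'
    have han := (analyticOrderAt_ne_zero.1 h0).1
    have e : pullbackMult (fun z => h (α z)) (h (α z)) z
        = pullbackMult h (h (α z)) (α z) * analyticOrderAt (fun w => α w - α z) z :=
      han.analyticOrderAt_comp (hα z hz)
    have hone : 1 ≤ analyticOrderAt (fun w => α w - α z) z := by
      rw [Order.one_le_iff_ne_zero, analyticOrderAt_ne_zero]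
      exact ⟨(hα z hz).sub analyticAt_const, sub_self _⟩
    rw [e]
    exact h1.trans (le_mul_of_one_le_right' hone)

lemma IsOrbifoldHolomorphicOn.comp_affine {Δ : OrbifoldDivisor X} {h : ℂ → X} {S S' : Set ℂ}
    (hh : IsOrbifoldHolomorphicOn Δ h S) {a b : ℂ} (hmaps : MapsTo (fun z => a + b * z) S' S) :
    IsOrbifoldHolomorphicOn Δ (fun z => h (a + b * z)) S' :=
  hh.comp (fun z _ => by fun_prop) hmaps

lemma speed_comp_affine (ι : X → X) (h : ℂ → X) (a b z : ℂ) :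
    speed ι (fun z => h (a + b * z)) z = ‖b‖ * speed ι h (a + b * z) := by
  rw [speed, speed, chartSpeed, chartSpeed]
  rw [deriv_comp_mul_left b (fun w => chartAt ℂ (ι (h (a + b * z))) (h (a + w))),
    norm_smul, deriv_comp_const_add (fun w => chartAt ℂ (ι (h (a + b * z))) (h w))]

/-- The disc of radius `1 - ‖w‖` about `w` lies in the unit disc; rescale it to the unit disc and
apply the bound at its centre. -/
lemma speed_mul_le {Δ : OrbifoldDivisor X} {ι : X → X} {M : ℝ}
    (hM : ∀ h : ℂ → X, IsOrbifoldHolomorphicOn Δ h disc → speed ι h 0 ≤ M) {h : ℂ → X}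
    (hh : IsOrbifoldHolomorphicOn Δ h disc) {w : ℂ} (hw : w ∈ disc) :
    (1 - ‖w‖) * speed ι h w ≤ M := by
  have hw' : ‖w‖ < 1 := by simpa using hw
  have hmaps : MapsTo (fun z => w + ((1 - ‖w‖ : ℝ) : ℂ) * z) disc disc := by
    intro z hz
    have hz' : ‖z‖ < 1 := by simpa using hz
    rw [mem_ball_zero_iff]
    refine (norm_add_le _ _).trans_lt ?_
    rw [norm_mul, Complex.norm_real, Real.norm_eq_abs, abs_of_pos (by linarith)]
    nlinarith
  have := hM _ (hh.comp_affine hmaps)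
  rwa [speed_comp_affine, mul_zero, add_zero, Complex.norm_real, Real.norm_eq_abs,
    abs_of_pos (by linarith)] at this

open Classical in
/-- A bump function around `p`, supported in a coordinate disc. -/
noncomputable def bump (p q : X) : ℝ :=
  if q ∈ (chartAt ℂ p).source then
    max 0 (1 - ‖chartAt ℂ p q - chartAt ℂ p p‖ / chartRadius p) else 0

lemma bump_nonneg (p q : X) : 0 ≤ bump p q := by
  unfold bump; split_ifs <;> simp

lemma bump_le_one (p q : X) : bump p q ≤ 1 := by
  unfold bump
  have := chartRadius_pos p
  split_ifs
  · exact max_le zero_le_one (sub_le_self _ (by positivity))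
  · exact zero_le_one

lemma bump_self (p : X) : bump p p = 1 := by simp [bump]

lemma bump_lt_one {p q : X} (h : p ≠ q) : bump p q < 1 := by
  unfold bump
  have := chartRadius_pos p
  split_ifs with hq
  · refine max_lt zero_lt_one (sub_lt_self _ (div_pos (norm_pos_iff.2 (sub_ne_zero.2 ?_)) this))
    exact fun e => h ((chartAt ℂ p).injOn hq (mem_chart_source ℂ p) e).symm
  · exact zero_lt_one

lemma mem_coordDisc_of_bump_ne_zero {p q : X} (h : bump p q ≠ 0) :
    q ∈ coordDisc p (chartRadius p) := by
  unfold bump at h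
  split_ifs at h with hq
  · refine ⟨hq, ?_⟩
    rw [mem_preimage, mem_ball, dist_eq_norm, ← div_lt_one (chartRadius_pos p)]
    by_contra! hcon
    exact h (max_eq_left (by linarith))
  · exact absurd rfl h

lemma abs_bump_sub_le {p a b : X} (ha : a ∈ (chartAt ℂ p).source)
    (hb : b ∈ (chartAt ℂ p).source) :
    |bump p a - bump p b| ≤ ‖chartAt ℂ p a - chartAt ℂ p b‖ / chartRadius p := by
  have hs := chartRadius_pos p
  rw [bump, bump, if_pos ha, if_pos hb, max_comm 0, max_comm 0]
  refine (abs_max_sub_max_le_abs _ _ _).trans ?_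
  have e : (1 - ‖chartAt ℂ p a - chartAt ℂ p p‖ / chartRadius p) -
      (1 - ‖chartAt ℂ p b - chartAt ℂ p p‖ / chartRadius p)
      = (‖chartAt ℂ p b - chartAt ℂ p p‖ - ‖chartAt ℂ p a - chartAt ℂ p p‖) / chartRadius p := by
    ring
  rw [e, abs_div, abs_of_pos hs]
  refine div_le_div_of_nonneg_right ((abs_norm_sub_norm_le _ _).trans ?_) hs.le
  rw [sub_sub_sub_cancel_right, norm_sub_rev]

variable [IsManifold 𝓘(ℂ) 1 X] [T2Space X]

/-- If the speed at the centre of the disc is bounded on orbifold holomorphic maps, then the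
differences of a bump function are bounded by the Poincaré distance along these maps. -/
lemma exists_abs_bump_sub_le {Δ : OrbifoldDivisor X} {ι : X → X} (hfin : (range ι).Finite)
    (hι : ∀ q, q ∈ coordDisc (ι q) (chartRadius (ι q))) {M : ℝ}
    (hM : ∀ h : ℂ → X, IsOrbifoldHolomorphicOn Δ h disc → speed ι h 0 ≤ M) (p : X) :
    ∃ c : ℝ, 0 < c ∧ ∀ h : ℂ → X, IsOrbifoldHolomorphicOn Δ h disc → ∀ z ∈ disc, ∀ w ∈ disc,
      c * |bump p (h z) - bump p (h w)| ≤ poincareDist z w := by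
  obtain ⟨ρ, C, hρ, hC, hmap⟩ := exists_mapsTo_coordCompact hfin hι p
  have hs := chartRadius_pos p
  set s := chartRadius p
  set M' := max M 1 with hM'
  have hM'pos : 0 < M' := by positivity
  set r := min (1 / 2) (ρ / (2 * M')) with hr
  have hr0 : 0 < r := by positivity
  have hr1 : r ≤ 1 / 2 := min_le_left _ _
  have hr2 : r * (2 * M') ≤ ρ := by
    rw [← le_div_iff₀ (by positivity)]; exact min_le_right _ _
  -- The first term serves points with `‖z - w‖ ≥ r * (1 - ‖w‖)`, where only `bump ≤ 1` is used. The
  -- second serves nearby points: `6` is the `2` of the speed bound `2M' / (1 - ‖w‖)` times the `3`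
  -- of `‖1 - conj w * z‖ ≤ 3 * (1 - ‖w‖)`.
  set c := min (r / (2 + r)) (s / (6 * C * M')) with hc
  have hc0 : 0 < c := by positivity
  refine ⟨c, hc0, fun h hh => ?_⟩
  have key : ∀ z ∈ disc, ∀ w ∈ disc, bump p (h w) ≠ 0 →
      c * |bump p (h z) - bump p (h w)| ≤ poincareDist z w := by
    intro z hz w hw hne
    refine le_trans ?_ (le_poincareDist hz hw)
    have hD := norm_one_sub_conj_mul_le (z := z) hw
    have hDpos : 0 < ‖1 - conj w * z‖ := (norm_nonneg _).trans_lt (norm_sub_lt_norm_one_sub hz hw)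
    have hw' : ‖w‖ < 1 := by simpa using hw
    have hd : 0 < 1 - ‖w‖ := by linarith
    rw [le_div_iff₀ hDpos]
    rcases lt_or_ge ‖z - w‖ (r * (1 - ‖w‖)) with hlt | hge
    · have hball : ∀ ζ ∈ ball w (r * (1 - ‖w‖)), ζ ∈ disc ∧ speed ι h ζ ≤ 2 * M' / (1 - ‖w‖) := by
        intro ζ hζ
        rw [mem_ball, dist_eq_norm] at hζ
        have h1 : ‖ζ‖ - ‖w‖ ≤ ‖ζ - w‖ := norm_sub_norm_le _ _
        have h2 : (1 - ‖w‖) / 2 ≤ 1 - ‖ζ‖ := by nlinarith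
        have hζd : ζ ∈ disc := by rw [mem_ball_zero_iff]; linarith
        refine ⟨hζd, ?_⟩
        have h3 := (speed_mul_le hM hh hζd).trans (le_max_left M 1)
        have h4 : 0 ≤ speed ι h ζ := norm_nonneg _
        rw [le_div_iff₀ hd]
        nlinarith
      have hrB : r * (1 - ‖w‖) * (2 * M' / (1 - ‖w‖)) ≤ ρ := by
        have : r * (1 - ‖w‖) * (2 * M' / (1 - ‖w‖)) = r * (2 * M') := by field_simp
        rwa [this]
      have hK := hmap h w (r * (1 - ‖w‖)) (2 * M' / (1 - ‖w‖)) hrB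
        (fun ζ hζ => hh.mdifferentiableAt ζ (hball ζ hζ).1) (fun ζ hζ => (hball ζ hζ).2)
        (mem_coordDisc_of_bump_ne_zero hne)
      have hzb : z ∈ ball w (r * (1 - ‖w‖)) := by rwa [mem_ball, dist_eq_norm]
      have hwb : w ∈ ball w (r * (1 - ‖w‖)) := mem_ball_self (by positivity)
      have hlip := norm_chartAt_sub_le (convex_ball w (r * (1 - ‖w‖)))
        (fun ζ hζ => hh.mdifferentiableAt ζ (hball ζ hζ).1)
        (fun ζ hζ => coordCompact_subset_source p (hK ζ hζ).1) (fun ζ hζ => (hK ζ hζ).2) hzb hwb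
      have hb := abs_bump_sub_le (coordCompact_subset_source p (hK z hzb).1)
        (coordCompact_subset_source p (hK w hwb).1)
      have hcs : c ≤ s / (6 * C * M') := min_le_right _ _
      have hD3 : ‖1 - conj w * z‖ ≤ 3 * (1 - ‖w‖) := by nlinarith
      calc c * |bump p (h z) - bump p (h w)| * ‖1 - conj w * z‖
          ≤ s / (6 * C * M') * ((C * (2 * M' / (1 - ‖w‖)) * ‖z - w‖) / s) * (3 * (1 - ‖w‖)) := by
            gcongr
            exact hb.trans (div_le_div_of_nonneg_right hlip hs.le)
        _ = ‖z - w‖ := by field_simp; ring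
    · have h1 : |bump p (h z) - bump p (h w)| ≤ 1 := by
        rw [abs_le]
        constructor <;> linarith [bump_nonneg p (h z), bump_nonneg p (h w), bump_le_one p (h z),
          bump_le_one p (h w)]
      have hcs : c ≤ r / (2 + r) := min_le_left _ _
      calc c * |bump p (h z) - bump p (h w)| * ‖1 - conj w * z‖
          ≤ r / (2 + r) * 1 * (2 * (1 - ‖w‖) + ‖z - w‖) := by gcongr
        _ ≤ ‖z - w‖ := by
            rw [mul_one, div_mul_eq_mul_div, div_le_iff₀ (by positivity)]
            nlinarith
  intro z hz w hw
  -- `key` must be centred at a point mapped into the coordinate disc of `p`; if only `z` is, the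
  -- roles are exchanged.
  by_cases h1 : bump p (h w) = 0
  · by_cases h2 : bump p (h z) = 0
    · rw [h1, h2, sub_zero, abs_zero, mul_zero]
      exact (by positivity : (0 : ℝ) ≤ _).trans (le_poincareDist hz hw)
    · rw [abs_sub_comm, poincareDist_comm]
      exact key w hw z hz h2
  · exact key z hz w hw h1

/-- A bound on the speed of orbifold discs at the centre implies hyperbolicity. -/
lemma isOrbifoldHyperbolic_of_speed_le {Δ : OrbifoldDivisor X} {ι : X → X}
    (hfin : (range ι).Finite) (hι : ∀ q, q ∈ coordDisc (ι q) (chartRadius (ι q))) {M : ℝ}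
    (hM : ∀ h : ℂ → X, IsOrbifoldHolomorphicOn Δ h disc → speed ι h 0 ≤ M) :
    IsOrbifoldHyperbolic Δ := by
  intro x _ y _ hxy
  by_contra hne
  obtain ⟨c, hc, hbound⟩ := exists_abs_bump_sub_le hfin hι hM x
  have hδ : IsDiscDecreasing Δ fun a b => c * |bump x a - bump x b| :=
    { pseudodist :=
        { nonneg := fun a _ b _ => by positivity
          self := fun a _ => by simp
          symm := fun a _ b _ => by rw [abs_sub_comm]
          triangle := fun a _ b _ d _ => by
            rw [← mul_add]
            exact mul_le_mul_of_nonneg_left (abs_sub_le _ _ _) hc.le }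
      decreasing := fun h hh => hbound h hh.isOrbifoldHolomorphicOn }
  have hle : ENNReal.ofReal (c * |bump x x - bump x y|) ≤ kobayashiDist Δ x y :=
    le_iSup₂_of_le _ hδ le_rfl
  rw [hxy, nonpos_iff_eq_zero, ENNReal.ofReal_eq_zero, bump_self] at hle
  have : 0 < c * |1 - bump x y| :=
    mul_pos hc (abs_pos.2 (sub_ne_zero.2 (bump_lt_one hne).ne'))
  linarith

end Orbicurve

/-! ### Brody reparametrization and passage to the limit -/

namespace Orbicurve
open Filter Metric Set

variable {X : Type*} [TopologicalSpace X] [ChartedSpace ℂ X] [IsManifold 𝓘(ℂ) 1 X] [T2Space X]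

/-- `speed` may jump with `ι`, so continuity is not available directly; locally it is dominated by
the continuous speed in a fixed chart. -/
lemma bddAbove_speed {Δ : OrbifoldDivisor X} {ι : X → X} (hfin : (range ι).Finite)
    (hι : ∀ q, q ∈ coordDisc (ι q) (chartRadius (ι q))) {h : ℂ → X} {S K : Set ℂ} (hS : IsOpen S)
    (hh : IsOrbifoldHolomorphicOn Δ h S) (hK : IsCompact K) (hKS : K ⊆ S) :
    BddAbove (speed ι h '' K) := by
  refine hK.induction_on (p := fun T => BddAbove (speed ι h '' T)) (by simp)
    (fun s t hst ht => ht.mono (image_mono hst)) (fun s t hs ht => ?_) fun z hz => ?_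
  · rw [image_union]; exact hs.union ht
  · obtain ⟨C, hC0, hC⟩ := exists_speed_comparison hfin hι (h z)
    have hzS := hS.mem_nhds (hKS hz)
    have hev : ∀ᶠ w in 𝓝 z, w ∈ S ∧ h w ∈ coordDisc (h z) (chartRadius (h z)) :=
      Eventually.and hzS ((hh.mdifferentiableAt z (hKS hz)).continuousAt.preimage_mem_nhds
        ((isOpen_coordDisc _ _).mem_nhds (mem_coordDisc (h z))))
    have hdiff : ∀ᶠ w in 𝓝 z, DifferentiableAt ℂ (fun w => chartAt ℂ (h z) (h w)) w :=
      hev.mono fun w hw => differentiableAt_chartAt_comp (hh.mdifferentiableAt w hw.1) hw.2.1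
    have hcont : ContinuousAt (fun w => chartSpeed (h z) h w) z :=
      (Complex.analyticAt_iff_eventually_differentiableAt.2 hdiff).deriv.continuousAt.norm
    have hlt : ∀ᶠ w in 𝓝 z, chartSpeed (h z) h w < chartSpeed (h z) h z + 1 :=
      hcont.eventually (gt_mem_nhds (lt_add_one _))
    refine ⟨_, mem_nhdsWithin_of_mem_nhds (hev.and hlt), C * (chartSpeed (h z) h z + 1), ?_⟩
    rintro _ ⟨w, ⟨hw, hwlt⟩, rfl⟩
    exact ((hC h w (hh.mdifferentiableAt w hw.1) (coordDisc_subset _ hw.2)).2).trans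
      (mul_le_mul_of_nonneg_left hwlt.le hC0.le)

/-- Brody's reparametrization: if the speed at the centre is unbounded, there are orbifold
holomorphic maps of speed `1` at the centre and bounded speed on arbitrarily large discs. -/
lemma exists_rescaled {Δ : OrbifoldDivisor X} {ι : X → X} (hfin : (range ι).Finite)
    (hι : ∀ q, q ∈ coordDisc (ι q) (chartRadius (ι q)))
    (hunb : ∀ M : ℝ, ∃ h : ℂ → X, IsOrbifoldHolomorphicOn Δ h disc ∧ M < speed ι h 0)
    {R : ℝ} (hR : 0 < R) :
    ∃ f : ℂ → X, IsOrbifoldHolomorphicOn Δ f (ball 0 R) ∧ speed ι f 0 = 1 ∧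
      ∀ z ∈ ball (0 : ℂ) R, speed ι f z ≤ 4 := by
  -- This gives `F 0 > 4R`, hence `d * ν = F z₁ > 2R`, so rescaling by `ν⁻¹` keeps the disc of
  -- radius `R` within `d/2` of `z₁`.
  obtain ⟨h, hh, hM⟩ := hunb (8 * R)
  have hsub : closedBall (0 : ℂ) (1 / 2) ⊆ disc := closedBall_subset_ball (by norm_num)
  obtain ⟨A, hA⟩ := bddAbove_speed hfin hι isOpen_ball hh (isCompact_closedBall 0 (1 / 2)) hsub
  set F : ℂ → ℝ := fun z => (1 / 2 - ‖z‖) * speed ι h z with hF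
  have hspeed : ∀ z, 0 ≤ speed ι h z := fun z => norm_nonneg _
  have hbdd : BddAbove (F '' closedBall 0 (1 / 2)) := by
    refine ⟨A, ?_⟩
    rintro _ ⟨z, hz, rfl⟩
    have h1 : speed ι h z ≤ A := hA ⟨z, hz, rfl⟩
    have h2 := hspeed z
    have h3 := norm_nonneg z
    simp only [hF]
    nlinarith
  have h0mem : F 0 ∈ F '' closedBall 0 (1 / 2) := ⟨0, mem_closedBall_self (by norm_num), rfl⟩
  set σ := sSup (F '' closedBall 0 (1 / 2)) with hσ
  have hσ0 : F 0 ≤ σ := le_csSup hbdd h0mem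
  have hF0 : 4 * R < F 0 := by simp only [hF, norm_zero]; linarith
  -- The supremum need not be attained; a point reaching half of it suffices. This costs a factor
  -- `2`, and the shrunken distance `d/2` another, whence the bound `4`.
  obtain ⟨_, ⟨z₁, hz₁, rfl⟩, hlt⟩ := exists_lt_of_lt_csSup ⟨_, h0mem⟩
    (show σ / 2 < σ by linarith)
  have hz₁' : ‖z₁‖ ≤ 1 / 2 := by simpa using hz₁
  have hFpos : 0 < F z₁ := by linarith
  have hd : 0 < 1 / 2 - ‖z₁‖ := pos_of_mul_pos_left hFpos (hspeed z₁)
  have hν : 0 < speed ι h z₁ := pos_of_mul_pos_right hFpos hd.le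
  set ν := speed ι h z₁ with hνdef
  set d := 1 / 2 - ‖z₁‖ with hddef
  have hF1 : F z₁ = d * ν := rfl
  have hball : ∀ ζ ∈ ball (0 : ℂ) R, ‖z₁ + ((ν⁻¹ : ℝ) : ℂ) * ζ‖ ≤ 1 / 2 - d / 2 := by
    intro ζ hζ
    rw [mem_ball_zero_iff] at hζ
    have h1 : ‖((ν⁻¹ : ℝ) : ℂ) * ζ‖ ≤ d / 2 := by
      rw [norm_mul, Complex.norm_real, Real.norm_eq_abs, abs_of_pos (by positivity),
        inv_mul_le_iff₀ hν]
      nlinarith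
    linarith [norm_add_le z₁ (((ν⁻¹ : ℝ) : ℂ) * ζ)]
  refine ⟨fun ζ => h (z₁ + ((ν⁻¹ : ℝ) : ℂ) * ζ), hh.comp_affine fun ζ hζ => ?_, ?_, fun ζ hζ => ?_⟩
  · rw [mem_ball_zero_iff]; linarith [hball ζ hζ]
  · rw [speed_comp_affine, mul_zero, add_zero, Complex.norm_real, Real.norm_eq_abs,
      abs_of_pos (by positivity), ← hνdef, inv_mul_cancel₀ hν.ne']
  · rw [speed_comp_affine, Complex.norm_real, Real.norm_eq_abs, abs_of_pos (by positivity),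
      inv_mul_le_iff₀ hν]
    have hb := hball ζ hζ
    set ξ := z₁ + ((ν⁻¹ : ℝ) : ℂ) * ζ
    have h1 : F ξ ≤ σ := le_csSup hbdd ⟨ξ, by rw [mem_closedBall_zero_iff]; linarith, rfl⟩
    have h2 : d / 2 * speed ι h ξ ≤ F ξ :=
      mul_le_mul_of_nonneg_right (by linarith) (hspeed ξ)
    have h3 : d * speed ι h ξ ≤ d * (ν * 4) := by linarith
    exact le_of_mul_le_mul_left h3 hd

/-- Sequences of bounded speed converge, along an ultrafilter, to a holomorphic map: in the chart
at a point `p`, the convergence is locally uniform near every point mapped close to `p`. -/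
lemma exists_tendstoLocallyUniformlyOn {κ : Type*} {l : Filter κ} [l.NeBot]
    {ι : X → X} (hfin : (range ι).Finite)
    (hι : ∀ q, q ∈ coordDisc (ι q) (chartRadius (ι q))) {B : ℝ} (hB : 0 < B)
    (p : X) : ∃ C : ℝ, 0 < C ∧ ∀ {F : κ → ℂ → X} {f : ℂ → X},
    (∀ z, Tendsto (fun n => F n z) l (𝓝 (f z))) →
    (∀ R : ℝ, ∀ᶠ n in l, ∀ z ∈ ball (0 : ℂ) R, MDifferentiableAt 𝓘(ℂ) 𝓘(ℂ) (F n) z ∧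
      speed ι (F n) z ≤ B) →
    ∀ z₀ : ℂ, f z₀ ∈ coordDisc p (chartRadius p) → ∃ r, 0 < r ∧
      (∀ᶠ n in l, ∀ z ∈ ball z₀ r, MDifferentiableAt 𝓘(ℂ) 𝓘(ℂ) (F n) z ∧
        F n z ∈ coordCompact p ∧ chartSpeed p (F n) z ≤ C) ∧
      (∀ z ∈ ball z₀ r, f z ∈ coordCompact p) ∧
      TendstoLocallyUniformlyOn (fun n z => chartAt ℂ p (F n z)) (fun z => chartAt ℂ p (f z)) l
        (ball z₀ r) := by
  obtain ⟨ρ, C, hρ, hC, hmap⟩ := exists_mapsTo_coordCompact hfin hι p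
  refine ⟨C * B, by positivity, fun {F f} hlim hF z₀ hz₀ => ⟨ρ / B, by positivity, ?_⟩⟩
  have hsub : ball z₀ (ρ / B) ⊆ ball 0 (‖z₀‖ + ρ / B) :=
    ball_subset_ball' (by rw [dist_zero_right, add_comm])
  have hev : ∀ᶠ n in l, ∀ z ∈ ball z₀ (ρ / B), MDifferentiableAt 𝓘(ℂ) 𝓘(ℂ) (F n) z ∧
      F n z ∈ coordCompact p ∧ chartSpeed p (F n) z ≤ C * B := by
    filter_upwards [hF (‖z₀‖ + ρ / B), hlim z₀ |>.eventually ((isOpen_coordDisc p _).mem_nhds hz₀)]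
      with n hn hn0 z hz
    exact ⟨(hn z (hsub hz)).1, hmap (F n) z₀ (ρ / B) B (div_mul_cancel₀ _ hB.ne').le
      (fun w hw => (hn w (hsub hw)).1) (fun w hw => (hn w (hsub hw)).2) hn0 z hz⟩
  have hfK : ∀ z ∈ ball z₀ (ρ / B), f z ∈ coordCompact p := fun z hz =>
    (isCompact_coordCompact p).isClosed.mem_of_tendsto (hlim z) (hev.mono fun n hn => (hn z hz).2.1)
  refine ⟨hev, hfK, tendstoLocallyUniformlyOn_of_lipschitz (L := C * B) (by positivity) ?_ ?_⟩
  · filter_upwards [hev] with n hn z hz w hw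
    exact norm_chartAt_sub_le (convex_ball _ _) (fun ζ hζ => (hn ζ hζ).1)
      (fun ζ hζ => coordCompact_subset_source p (hn ζ hζ).2.1) (fun ζ hζ => (hn ζ hζ).2.2) hz hw
  · intro z hz
    exact ((chartAt ℂ p).continuousAt (coordCompact_subset_source p (hfK z hz))).tendsto.comp
      (hlim z)

/-- If the speed at the centre of orbifold holomorphic discs is unbounded, there is a nonconstant
entire orbifold holomorphic map whose derivative is bounded in every coordinate disc. -/
lemma exists_entire [CompactSpace X] {Δ : OrbifoldDivisor X} (hΔ : ∀ p, Δ.mult p ≠ ⊤) {ι : X → X}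
    (hfin : (range ι).Finite) (hι : ∀ q, q ∈ coordDisc (ι q) (chartRadius (ι q)))
    (hunb : ∀ M : ℝ, ∃ h : ℂ → X, IsOrbifoldHolomorphicOn Δ h disc ∧ M < speed ι h 0) :
    ∃ f : ℂ → X, IsOrbifoldHolomorphicOn Δ f univ ∧ (∃ a b, f a ≠ f b) ∧
      ∀ p : X, ∃ C : ℝ, ∀ z, f z ∈ coordDisc p (chartRadius p) → chartSpeed p f z ≤ C := by
  choose F hFhol hF0 hF4 using fun n : ℕ =>
    exists_rescaled hfin hι hunb (R := (n : ℝ) + 1) (by positivity)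
  -- Along an ultrafilter, compactness of `X` alone gives pointwise limits, with no diagonal
  -- extraction; the speed bound then makes the convergence locally uniform.
  set l : Ultrafilter ℕ := hyperfilter ℕ with hl
  have hlt : (l : Filter ℕ) ≤ atTop := by
    rw [← Nat.cofinite_eq_atTop]; exact hyperfilter_le_cofinite
  have hex : ∀ z, ∃ q, Tendsto (fun n => F n z) l (𝓝 q) := fun z => by
    obtain ⟨q, -, hq⟩ := isCompact_univ.ultrafilter_le_nhds (l.map fun n => F n z) (by simp)
    exact ⟨q, hq⟩
  choose f hf using hex
  have hbig : ∀ R : ℝ, ∀ᶠ n : ℕ in (l : Filter ℕ), ball (0 : ℂ) R ⊆ ball 0 ((n : ℝ) + 1) := by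
    intro R
    obtain ⟨N, hN⟩ := exists_nat_gt R
    filter_upwards [hlt (eventually_ge_atTop N)] with n hn
    exact ball_subset_ball (by have : (N : ℝ) ≤ n := Nat.cast_le.2 hn; linarith)
  have hFB : ∀ R : ℝ, ∀ᶠ n in (l : Filter ℕ), ∀ z ∈ ball (0 : ℂ) R,
      MDifferentiableAt 𝓘(ℂ) 𝓘(ℂ) (F n) z ∧ speed ι (F n) z ≤ 4 := fun R =>
    (hbig R).mono fun n hn z hz => ⟨(hFhol n).mdifferentiableAt z (hn hz), hF4 n z (hn hz)⟩
  have hconv := fun p => exists_tendstoLocallyUniformlyOn (l := (l : Filter ℕ)) hfin hι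
    (B := 4) (by norm_num) p
  have hdiff : ∀ {p : X} {z₀ : ℂ} {r C : ℝ}, (∀ᶠ n in (l : Filter ℕ), ∀ z ∈ ball z₀ r,
      MDifferentiableAt 𝓘(ℂ) 𝓘(ℂ) (F n) z ∧ F n z ∈ coordCompact p ∧ chartSpeed p (F n) z ≤ C) →
      ∀ᶠ n in (l : Filter ℕ), DifferentiableOn ℂ (fun z => chartAt ℂ p (F n z)) (ball z₀ r) :=
    fun h => h.mono fun n hn z hz => (differentiableAt_chartAt_comp (hn z hz).1
      (coordCompact_subset_source _ (hn z hz).2.1)).differentiableWithinAt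
  refine ⟨f, ⟨fun z₀ _ => ?_, fun z₀ _ _ => ?_⟩, ?_, fun p => ?_⟩
  · obtain ⟨C, hC, hloc⟩ := hconv (f z₀)
    obtain ⟨r, hr, hev, hfK, hu⟩ := hloc hf hFB z₀ (mem_coordDisc _)
    have hd := (hu.differentiableOn (hdiff hev) isOpen_ball).differentiableAt
      (ball_mem_nhds z₀ hr)
    have hs : MDifferentiableAt 𝓘(ℂ) 𝓘(ℂ) (chartAt ℂ (f z₀)).symm (chartAt ℂ (f z₀) (f z₀)) :=
      mdifferentiableAt_atlas_symm (chart_mem_atlas ℂ _) (mem_chart_target ℂ _)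
    refine (hs.comp z₀ hd.mdifferentiableAt).congr_of_eventuallyEq ?_
    filter_upwards [ball_mem_nhds z₀ hr] with z hz
    exact ((chartAt ℂ (f z₀)).left_inv (coordCompact_subset_source _ (hfK z hz))).symm
  · obtain ⟨C, hC, hloc⟩ := hconv (f z₀)
    obtain ⟨r, hr, hev, hfK, hu⟩ := hloc hf hFB z₀ (mem_coordDisc _)
    obtain ⟨m, hm⟩ := ENat.ne_top_iff_exists.1 (hΔ (f z₀))
    rw [pullbackMult, ← hm]
    set c := chartAt ℂ (f z₀) (f z₀) with hc
    have hu' : TendstoLocallyUniformlyOn (fun n z => chartAt ℂ (f z₀) (F n z) - c)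
        (fun z => chartAt ℂ (f z₀) (f z) - c) l (ball z₀ r) := by
      rw [Metric.tendstoLocallyUniformlyOn_iff] at hu ⊢
      simpa only [dist_sub_right] using hu
    refine le_analyticOrderAt_of_tendstoLocallyUniformlyOn isOpen_ball
      ((hdiff hev).mono fun n hn => hn.sub_const c) hu' (mem_ball_self hr) (sub_self _) ?_
    filter_upwards [hev, hbig (‖z₀‖ + r)] with n hn hnb z hz hz0
    have hzb : z ∈ ball (0 : ℂ) ((n : ℝ) + 1) :=
      hnb (ball_subset_ball' (by rw [dist_zero_right, add_comm]) hz)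
    have heq : F n z = f z₀ := (chartAt ℂ (f z₀)).injOn
      (coordCompact_subset_source _ (hn z hz).2.1) (mem_chart_source ℂ _) (sub_eq_zero.1 hz0)
    by_cases hsupp : f z₀ ∈ Δ.support
    · have := (hFhol n).mult_le z hzb (heq ▸ hsupp)
      rw [heq] at this
      rwa [hm]
    · have h1 : Δ.mult (f z₀) = 1 := by simpa [OrbifoldDivisor.support] using hsupp
      rw [hm, h1, Order.one_le_iff_ne_zero, analyticOrderAt_ne_zero]
      refine ⟨DifferentiableOn.analyticAt (s := ball z₀ r) (fun w hw => ?_)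
        (isOpen_ball.mem_nhds hz), hz0⟩
      exact ((differentiableAt_chartAt_comp (hn w hw).1
        (coordCompact_subset_source _ (hn w hw).2.1)).sub_const c).differentiableWithinAt
  -- Derivatives in the chart at `f 0` converge. Those of `F n` at `0` stay above `A⁻¹` because the
  -- speed there is `1`, while a constant limit would have derivative `0`.
  · by_contra! hconst
    obtain ⟨C, hC, hloc⟩ := hconv (f 0)
    obtain ⟨r, hr, hev, hfK, hu⟩ := hloc hf hFB 0 (mem_coordDisc _)
    obtain ⟨A, hA0, hA⟩ := exists_speed_comparison hfin hι (f 0)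
    have hder := (hu.deriv (hdiff hev) isOpen_ball).tendsto_at (mem_ball_self hr)
    have hzero : deriv (fun z => chartAt ℂ (f 0) (f z)) 0 = 0 := by
      have : (fun z => chartAt ℂ (f 0) (f z)) = fun _ => chartAt ℂ (f 0) (f 0) :=
        funext fun z => by rw [hconst z 0]
      rw [this, deriv_const]
    rw [hzero] at hder
    have hge : ∀ᶠ n in (l : Filter ℕ), A⁻¹ ≤ ‖deriv (fun z => chartAt ℂ (f 0) (F n z)) 0‖ := by
      filter_upwards [hev] with n hn
      have h1 := hn 0 (mem_ball_self hr)
      have h2 := (hA (F n) 0 h1.1 h1.2.1).2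
      rw [hF0 n] at h2
      rw [inv_le_iff_one_le_mul₀' hA0]
      exact h2
    have h3 := ge_of_tendsto hder.norm hge
    rw [norm_zero] at h3
    exact absurd h3 (not_le.2 (inv_pos.2 hA0))
  · obtain ⟨C, hC, hloc⟩ := hconv p
    refine ⟨C, fun z hz => ?_⟩
    obtain ⟨r, hr, hev, hfK, hu⟩ := hloc hf hFB z hz
    have hder := (hu.deriv (hdiff hev) isOpen_ball).tendsto_at (mem_ball_self hr)
    exact le_of_tendsto hder.norm (hev.mono fun n hn => (hn z (mem_ball_self hr)).2.2)

end Orbicurve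

/-! ### Hermitian metrics, morphisms from the plane, and the conclusion -/

namespace Orbicurve
open Filter Metric Set

section

variable {X : Type*} [TopologicalSpace X] [ChartedSpace ℂ X] [IsManifold 𝓘(ℂ) 1 X]

/-- On a compact coordinate disc, the length of a derivative with respect to a hermitian metric is
controlled by its size in the chart. -/
lemma HermitianMetric.exists_norm_mfderiv_le (g : HermitianMetric X) (p : X) :
    ∃ A : ℝ, ∀ (f : ℂ → X) (z : ℂ), MDifferentiableAt 𝓘(ℂ) 𝓘(ℂ) f z → f z ∈ coordCompact p →
      g.norm (f z) (mfderiv 𝓘(ℂ) 𝓘(ℂ) f z (1 : ℂ)) ≤ chartSpeed p f z * A := by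
  set e := trivializationAt ℂ (TangentSpace 𝓘(ℂ) : X → Type) p with he
  have hbase : e.baseSet = (chartAt ℂ p).source := TangentBundle.trivializationAt_baseSet p
  have hcont : ContinuousOn (fun q : X => (g.form q (e.symm q 1) (e.symm q 1)).re)
      (coordCompact p) := by
    have h1 : ContinuousOn (fun q : X => (⟨q, e.symm q 1⟩ : TangentBundle 𝓘(ℂ) X)) e.baseSet :=
      e.continuousOn_symm.comp (f := fun q : X => (q, (1 : ℂ))) (by fun_prop)
        fun q hq => ⟨hq, mem_univ _⟩
    exact g.continuous_form.comp_continuousOn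
      (h1.mono (hbase ▸ coordCompact_subset_source p))
  obtain ⟨A, hA⟩ := (isCompact_coordCompact p).exists_bound_of_continuousOn hcont
  refine ⟨√A, fun f z hf hz => ?_⟩
  have hsrc := coordCompact_subset_source p hz
  set v := mfderiv 𝓘(ℂ) 𝓘(ℂ) f z (1 : ℂ) with hv
  set d : ℂ := deriv (fun w => chartAt ℂ p (f w)) z with hd
  have hdv : e.continuousLinearMapAt ℂ (f z) v = d := by
    rw [show e.continuousLinearMapAt ℂ (f z) = mfderiv 𝓘(ℂ) 𝓘(ℂ) (extChartAt 𝓘(ℂ) p) (f z) from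
      TangentBundle.continuousLinearMapAt_trivializationAt hsrc]
    have hc := mfderiv_comp z (mdifferentiableAt_extChartAt (I := 𝓘(ℂ)) hsrc) hf
    have h2 : mfderiv 𝓘(ℂ) 𝓘(ℂ) (extChartAt 𝓘(ℂ) p ∘ f) z (1 : ℂ) = d := by
      rw [mfderiv_eq_fderiv, hd, ← fderiv_apply_one_eq_deriv]
      rfl
    rw [hc] at h2
    exact h2
  -- The tangent space is a line, so the length of `v` is `‖d‖` times that of the local frame
  -- vector, which is bounded on the compact disc.
  have hvd : v = d • e.symm (f z) 1 := by
    have h1 := e.symmL_continuousLinearMapAt (R := ℂ) (hbase ▸ hsrc) v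
    rw [hdv, ← mul_one d, ← smul_eq_mul, map_smul, e.symmL_apply (hbase ▸ hsrc)] at h1
    exact h1.symm
  have hform : (g.form (f z) v v).re
      = ‖d‖ ^ 2 * (g.form (f z) (e.symm (f z) 1) (e.symm (f z) 1)).re := by
    rw [hvd, map_smul, LinearMap.map_smulₛₗ, LinearMap.smul_apply, smul_eq_mul, smul_eq_mul,
      ← mul_assoc, mul_comm d, ← Complex.normSq_eq_conj_mul_self, Complex.re_ofReal_mul,
      Complex.normSq_eq_norm_sq]
  rw [HermitianMetric.norm, hform, Real.sqrt_mul (sq_nonneg _), Real.sqrt_sq (norm_nonneg _)]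
  exact mul_le_mul_of_nonneg_left (Real.sqrt_le_sqrt ((le_abs_self _).trans (hA _ hz)))
    (norm_nonneg _)

lemma hasBoundedDerivative_of_chartSpeed_le {ι : X → X} (hfin : (range ι).Finite)
    (hι : ∀ q, q ∈ coordDisc (ι q) (chartRadius (ι q))) {f : ℂ → X}
    (hf : ∀ z, MDifferentiableAt 𝓘(ℂ) 𝓘(ℂ) f z)
    (hb : ∀ p : X, ∃ C : ℝ, ∀ z, f z ∈ coordDisc p (chartRadius p) → chartSpeed p f z ≤ C) :
    HasBoundedDerivative f := by
  intro g
  choose C hC using hb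
  choose A hA using g.exists_norm_mfderiv_le
  obtain ⟨B, hB⟩ := (hfin.image fun p => C p * |A p|).bddAbove
  refine ⟨B, fun z => ?_⟩
  have hz := hι (f z)
  calc g.norm (f z) (mfderiv 𝓘(ℂ) 𝓘(ℂ) f z (1 : ℂ))
      ≤ chartSpeed (ι (f z)) f z * A (ι (f z)) := hA _ f z (hf z) (coordDisc_subset _ hz)
    _ ≤ chartSpeed (ι (f z)) f z * |A (ι (f z))| :=
        mul_le_mul_of_nonneg_left (le_abs_self _) (norm_nonneg _)
    _ ≤ C (ι (f z)) * |A (ι (f z))| := mul_le_mul_of_nonneg_right (hC _ z hz) (abs_nonneg _)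
    _ ≤ B := hB ⟨_, mem_range_self _, rfl⟩

end

variable {X : Type*} [TopologicalSpace X]

lemma OrbifoldDivisor.support_finite [CompactSpace X] (Δ : OrbifoldDivisor X) :
    Δ.support.Finite := by
  choose U hU hfin using Δ.locallyFinite
  obtain ⟨t, ht⟩ := CompactSpace.elim_nhds_subcover U hU
  refine (t.finite_toSet.biUnion fun x _ => hfin x).subset fun p hp => ?_
  have : p ∈ ⋃ x ∈ t, U x := ht ▸ mem_univ p
  simp only [mem_iUnion] at this ⊢
  obtain ⟨x, hx, hpx⟩ := this
  exact ⟨x, hx, hpx, hp⟩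

variable [T2Space X] [ChartedSpace ℂ X]

/-- A nonconstant entire orbifold holomorphic map is an orbifold morphism from `ℂ`. -/
lemma IsOrbifoldHolomorphicOn.isOrbifoldMorphism [CompactSpace X] {Δ : OrbifoldDivisor X}
    (hΔ : Δ.infPart = ∅) {f : ℂ → X} (hf : IsOrbifoldHolomorphicOn Δ f univ)
    (hne : ∃ a b, f a ≠ f b) : IsOrbifoldMorphism (OrbifoldDivisor.empty ℂ) Δ f where
  holo := fun z _ => (hf.mdifferentiableAt z (mem_univ z)).mdifferentiableWithinAt
  not_subset := by
    have hempty : (OrbifoldDivisor.empty ℂ).infPart = ∅ := by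
      simp [OrbifoldDivisor.infPart, OrbifoldDivisor.empty]
    rw [hempty, compl_empty, image_univ]
    intro hsub
    obtain ⟨a, b, hab⟩ := hne
    have hcont : Continuous f := continuous_iff_continuousAt.2 fun z =>
      (hf.mdifferentiableAt z (mem_univ z)).continuousAt
    -- A connected set with two points in a Hausdorff space is infinite, but `|Δ|` is finite by
    -- compactness.
    exact (isPreconnected_range hcont).infinite_of_nontrivial
      ⟨f a, mem_range_self a, f b, mem_range_self b, hab⟩ (Δ.support_finite.subset hsub)
  comp_disc := fun g hg hsub => by
    have hgd : DifferentiableOn ℂ g disc := mdifferentiableOn_iff_differentiableOn.1 hg.holo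
    have hfg : IsOrbifoldHolomorphicOn Δ (fun z => f (g z)) disc :=
      hf.comp (fun z hz => hgd.analyticAt (isOpen_ball.mem_nhds hz)) fun z _ => mem_univ _
    exact
      { holo := fun z hz => (hfg.mdifferentiableAt z hz).mdifferentiableWithinAt
        not_subset := by rwa [image_comp, image_subset_iff]
        mult_le := hfg.mult_le
        avoid := fun z _ => by simp [hΔ] }

end Orbicurve

open Orbicurve in
theorem corollary3 {X : Type*} [TopologicalSpace X] [T2Space X] [ConnectedSpace X]
    [ChartedSpace ℂ X] [IsManifold 𝓘(ℂ) ω X]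
    (Δ : Orbicurve.OrbifoldDivisor X) (hΔ : Δ.IsCompactOrbifold) :
    Orbicurve.IsOrbifoldHyperbolic Δ ∨
      ∃ f : ℂ → X,
        Orbicurve.IsOrbifoldMorphism (Orbicurve.OrbifoldDivisor.empty ℂ) Δ f ∧
        (∃ a b : ℂ, f a ≠ f b) ∧
        Orbicurve.HasBoundedDerivative f := by
  have : CompactSpace X := hΔ.1
  obtain ⟨ι, hfin, hι⟩ := exists_finite_index X
  by_cases hb : ∃ M : ℝ, ∀ h : ℂ → X, IsOrbifoldHolomorphicOn Δ h disc → speed ι h 0 ≤ M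
  · obtain ⟨M, hM⟩ := hb
    exact Or.inl (isOrbifoldHyperbolic_of_speed_le hfin hι hM)
  · push Not at hb
    have hmult : ∀ p, Δ.mult p ≠ ⊤ := fun p hp =>
      (hΔ.2 ▸ (show p ∈ Δ.infPart from hp) : p ∈ (∅ : Set X))
    obtain ⟨f, hf, hne, hbd⟩ := exists_entire hmult hfin hι hb
    exact Or.inr ⟨f, hf.isOrbifoldMorphism hΔ.2 hne, hne,
      hasBoundedDerivative_of_chartSpeed_le hfin hι
        (fun z => hf.mdifferentiableAt z (Set.mem_univ z)) hbd⟩
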